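/- Let $\ell\ge 1$, $L=2^\ell$, and let $n$ be a number of iterations with $\ell\le 2^n$ (for instance $n=\ell$, or $n=\log_2\ell$ if $\ell$ is a power of two). A replicated secret sharing of $x\in\mathbb Z_m$ is a triple $(x_1,x_2,x_3)$ with $x_1+x_2+x_3\equiv x \pmod m$, where party $P_i$ holds $(x_i,x_{i+1})$ (indices modulo $3$). *Protocol $\Pi_{\mathsf{Pow}}$.* The parties $P_1,P_2,P_3$ hold consistent shares of some $b\in\mathbb Z_L$ with $1\le b<2^{\ell-1}$ (a positive number in two's complement). Set $\alpha\leftarrow 0$. For $i=n-1,\dots,1,0$: compute random shares modulo $2$ of the bit $c=\mathsf{DReLU}(b-2^{2^i+\alpha})$ (here $\mathsf{DReLU}(a)=1$ if the most significant bit of $a$ is $0$, and $\mathsf{DReLU}(a)=0$ otherwise; a constant $2^{e}$ with $e\ge\ell$, which is out of range, is replaced by $2^{\ell-1}$, which also exceeds every admissible $b$, and is not reduced modulo $L$); reconstruct $c$; if $c=1$, set $\alpha\leftarrow\alpha+2^i$. Output $\alpha$, each of whose bits is $c$ of the corresponding iteration. *Hybrid model.* Multiplication, $\mathsf{ReLU}$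 and $\mathsf{DReLU}$, reconstruction and preprocessing of correlated randomness are carried out by ideal functionalities with abort. Such a functionality collects the shares of all parties and aborts if they are inconsistent or if the corrupted party refuses to send its shares; otherwise it hands the corrupted party its output first, and the adversary then decides whether the honest parties receive theirs or the run is aborted for all of them. *Functionality $\mathcal F_{\mathsf{Pow}}$.* It receives the shares of $b$ from the three parties and aborts if they are inconsistent. Otherwise it computes $\alpha$ with $2^\alpha\le b<2^{\alpha+1}$ and reveals the $n$ bits $\alpha[n-1],\dots,\alpha[0]$ one after the other: bit $\alpha[k]$ is given to the adversary when it asks for it, and is then sent to the honest parties as well, before the next bit can be asked for. The adversary may abort at any time before the honest parties have received $\alpha[0]$. If it aborts at iteration $k$, then the honest parties have received exactly the bits $\alpha[i]$ with $i>k$ (followed by $\mathsf{Abort}$), the adversary has received at most the bits $\alpha[i]$ with $i\ge k$, and nothing else is revealed. If it does not abort, the honest parties obtain all bits of $\alpha$, and $\alpha$. **Theorem.** $\Pi_{\mathsf{Pow}}$ securely realizes $\mathcal F_{\mathsf{Pow}}$ with abort, in the presence of one malicious party, in the $(\mathcal F_{\mathsf{Mult}},\mathcal F_{\mathsf{ReLU}},\mathcal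 F_{\mathsf{Reconst}},\mathcal F_{\mathsf{Prep}})$-hybrid model, with perfect security. That is, whichever party is corrupted, there is a straight-line black-box simulator such that for every adversary and every consistent sharing of every $b$ with $1\le b<2^{\ell-1}$, the joint distribution of the view of the adversary and the outputs of the honest parties (the bits of $\alpha$ received, followed by $\alpha$ or by $\mathsf{Abort}$) in the execution of $\Pi_{\mathsf{Pow}}$ in the hybrid model is identical to the one in the ideal execution of the simulator with $\mathcal F_{\mathsf{Pow}}$. -/

import Mathlib

noncomputable section

namespace MPC

/-! ### Functionalities available in a hybrid model -/

/-- A trusted party for three parties: it collects one input from every party and then either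
aborts (`none`, the inputs are malformed) or produces one output for every party. -/
structure Functionality where
  In : Type
  Out : Type
  eval : (Fin 3 → In) → PMF (Option (Fin 3 → Out))

variable {ι : Type} (F : ι → Functionality)

/-- What the adversary sees and does during a run. -/
inductive Event where
  /-- The adversary sent `x` to `F q` for the corrupted party; `none` means that it refused. -/
  | input (q : ι) (x : Option (F q).In)
  /-- `F q` handed `y` to the corrupted party. -/
  | output (q : ι) (y : (F q).Out)
  /-- The adversary allowed (`true`) or refused (`false`) the honest parties their outputs. -/
  | deliver (q : ι) (b : Bool)
  /-- The adversary was told that `F q` aborted. -/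
  | aborted (q : ι)

/-- The view of the adversary, oldest event first. -/
abbrev View := List (Event F)

/-- A malicious adversary (randomized, with no bound on its running time). Its behaviour at
every activation is an arbitrary function of its whole view. -/
structure Adversary where
  /-- The message it sends to `F q` for the corrupted party. -/
  input : View F → (q : ι) → PMF (Option (F q).In)
  /-- Security with abort: after it has seen the output of the corrupted party it decides
  whether the honest parties receive theirs (`true`) or everything is aborted (`false`). -/
  deliver : View F → (q : ι) → PMF Bool

/-! ### Protocols and their execution in the hybrid model -/

/-- One round: every party calls the same functionality, with an input computed from its local
state, and updates its local state with the output it receives. -/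
structure Round (σ : Type) where
  call : ι
  send : Fin 3 → σ → (F call).In
  recv : Fin 3 → σ → (F call).Out → σ

/-- A three-party protocol with party inputs in `X` and party outputs in `Y`. -/
structure Protocol (X Y : Type) where
  State : Type
  start : Fin 3 → X → State
  rounds : List (Round F State)
  /-- Output of a party at the end of a completed run. -/
  finish : Fin 3 → State → Y
  /-- Output of a party when the run is aborted. -/
  abort : Fin 3 → State → Y

/-- The honest parties when `c` is corrupted. -/
abbrev Honest (c : Fin 3) := {j : Fin 3 // j ≠ c}

/-- The family that is `x` at `c` and `h` at the other two parties. -/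
def withCorrupt {X : Type} (c : Fin 3) (x : X) (h : Honest c → X) : Fin 3 → X :=
  fun j => if hj : j = c then x else h ⟨j, hj⟩

variable {F}

/-- Run the remaining `rounds` with corrupted party `c`, adversary `A`, local states `s` of the
honest parties and view `v` so far. The result is the joint distribution of the final view of
the adversary and the outputs of the honest parties. -/
def Protocol.run {X Y : Type} (P : Protocol F X Y) (c : Fin 3) (A : Adversary F) :
    List (Round F P.State) → (Honest c → P.State) → View F → PMF (View F × (Honest c → Y))
  | [], s, v => PMF.pure (v, fun j => P.finish j.1 (s j))
  | R :: rest, s, v =>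
    (A.input v R.call).bind fun x =>
      match x with
      | none =>
        PMF.pure (v ++ [Event.input R.call none], fun j => P.abort j.1 (s j))
      | some x =>
        ((F R.call).eval (withCorrupt c x fun j => R.send j.1 (s j))).bind fun y =>
          match y with
          | none =>
            PMF.pure (v ++ [Event.input R.call (some x), Event.aborted R.call],
              fun j => P.abort j.1 (s j))
          | some y =>
            let w := v ++ [Event.input R.call (some x), Event.output R.call (y c)]
            (A.deliver w R.call).bind fun b =>
              match b with
              | false =>
                PMF.pure (w ++ [Event.deliver R.call false], fun j => P.abort j.1 (s j))
              | true =>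
                P.run c A rest (fun j => R.recv j.1 (s j) (y j.1))
                  (w ++ [Event.deliver R.call true])

/-- The hybrid-model execution of a protocol on party inputs `x`. -/
def Protocol.exec {X Y : Type} (P : Protocol F X Y) (c : Fin 3) (A : Adversary F)
    (x : Fin 3 → X) : PMF (View F × (Honest c → Y)) :=
  P.run c A P.rounds (fun j => P.start j.1 (x j.1)) []

/-! ### The ideal model -/

/-- A reactive ideal functionality: it starts with the inputs of the honest parties, then
exchanges messages with the ideal-model adversary, and its final state determines what the
honest parties have received. -/
structure IdealFunctionality (X Y : Type) where
  State : Type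
  Msg : Type
  Reply : Type
  start : (c : Fin 3) → (Honest c → X) → State
  step : State → Msg → State × Reply
  out : State → Fin 3 → Y

/-- A straight-line black-box simulator: a program that draws uniform elements of finite sets,
talks to the ideal functionality, and talks to the adversary, in the role of the functionalities
of the hybrid model, in a single conversation that is never rewound. -/
inductive Simulator (F : ι → Functionality) (Msg Reply : Type) where
  | halt
  | uniform (m : ℕ) (k : Fin (m + 1) → Simulator F Msg Reply)
  /-- Let the adversary send its message for `F q`. -/
  | askInput (q : ι) (k : Option (F q).In → Simulator F Msg Reply)
  /-- Hand the adversary the output `y` of `F q`, and learn whether it lets `F q` deliver. -/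
  | giveOutput (q : ι) (y : (F q).Out) (k : Bool → Simulator F Msg Reply)
  /-- Tell the adversary that `F q` aborted. -/
  | tellAbort (q : ι) (k : Simulator F Msg Reply)
  /-- Send `m` to the ideal functionality. -/
  | ideal (m : Msg) (k : Reply → Simulator F Msg Reply)

/-- Run a simulator with oracle access to the adversary `A` in the ideal model of `G`, from the
state `s` of `G` and the view `v` of the adversary. -/
def Simulator.run {X Y : Type} (G : IdealFunctionality X Y) (c : Fin 3) (A : Adversary F) :
    Simulator F G.Msg G.Reply → G.State → View F → PMF (View F × (Honest c → Y))
  | .halt, s, v => PMF.pure (v, fun j => G.out s j.1)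
  | .uniform m k, s, v =>
    (PMF.uniformOfFintype (Fin (m + 1))).bind fun r => (k r).run G c A s v
  | .askInput q k, s, v =>
    (A.input v q).bind fun x => (k x).run G c A s (v ++ [Event.input q x])
  | .giveOutput q y k, s, v =>
    (A.deliver (v ++ [Event.output q y]) q).bind fun b =>
      (k b).run G c A s (v ++ [Event.output q y, Event.deliver q b])
  | .tellAbort q k, s, v => k.run G c A s (v ++ [Event.aborted q])
  | .ideal m k, s, v => (k (G.step s m).2).run G c A (G.step s m).1 v

/-- The ideal-model execution on party inputs `x`. -/
def Simulator.exec {X Y : Type} {G : IdealFunctionality X Y} (S : Simulator F G.Msg G.Reply)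
    (c : Fin 3) (A : Adversary F) (x : Fin 3 → X) : PMF (View F × (Honest c → Y)) :=
  S.run G c A (G.start c fun j => x j.1) []

/-- `P` securely realizes `G` with abort in the `F`-hybrid model, in the presence of one malicious
party, on all inputs that satisfy `D`: whichever party `c` is corrupted, there is one straight-line
black-box simulator such that for every adversary (which is given the input of the corrupted party)
and all inputs, the view of the adversary and the outputs of the honest parties have exactly the
same joint distribution in both executions. The simulator sees neither the inputs of the parties
nor the adversary's code. -/
def SecurelyRealizesWithAbort {X Y : Type} (P : Protocol F X Y) (G : IdealFunctionality X Y)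
    (D : (Fin 3 → X) → Prop) : Prop :=
  ∀ c : Fin 3, ∃ S : Simulator F G.Msg G.Reply,
    ∀ (A : X → Adversary F) (x : Fin 3 → X), D x →
      P.exec c (A (x c)) x = S.exec c (A (x c)) x

/-! ### Replicated secret sharing -/

/-- What one party holds of a replicated sharing modulo `m`. -/
abbrev Pair (m : ℕ) := ZMod m × ZMod m

/-- Party `i` holds the components `i` and `i + 1` (indices modulo 3) of the sharing `s`. -/
def pairs {m : ℕ} (s : Fin 3 → ZMod m) : Fin 3 → Pair m := fun i => (s i, s (i + 1))

/-- Recover the sharing from what the parties hold; `none` if the copies do not agree. -/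
def joinPairs {m : ℕ} (v : Fin 3 → Pair m) : Option (Fin 3 → ZMod m) :=
  if ∀ i, (v i).2 = (v (i + 1)).1 then some fun i => (v i).1 else none

/-- The secret behind a sharing. -/
def secret {m : ℕ} (s : Fin 3 → ZMod m) : ZMod m := s 0 + s 1 + s 2

/-- A uniformly random sharing of `a`. -/
def randomSharing {m : ℕ} [NeZero m] (a : ZMod m) : PMF (Fin 3 → ZMod m) :=
  (PMF.uniformOfFintype (ZMod m × ZMod m)).map fun r => ![r.1, r.2, a - r.1 - r.2]

/-- What a party holds of `x + t` for a public `t`, which is added to component `0`. -/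
def addPublic {m : ℕ} (t : ZMod m) (i : Fin 3) (x : Pair m) : Pair m :=
  (if i = 0 then x.1 + t else x.1, if i + 1 = 0 then x.2 + t else x.2)

/-! ### The hybrid model -/

/-- Multiplication: random shares of the product of two shared values. -/
abbrev multF (m : ℕ) [NeZero m] : Functionality where
  In := Pair m × Pair m
  Out := Pair m
  eval v :=
    match joinPairs fun i => (v i).1, joinPairs fun i => (v i).2 with
    | some x, some y => (randomSharing (secret x * secret y)).map fun z => some (pairs z)
    | _, _ => PMF.pure none

/-- Reconstruction of a shared value towards all parties. -/
abbrev reconstF (m : ℕ) : Functionality where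
  In := Pair m
  Out := ZMod m
  eval v := PMF.pure ((joinPairs v).map fun x _ => secret x)

/-- Derivative of ReLU: `1` if the most significant bit is `0` (non-negative), else `0`. -/
def drelu (ℓ : ℕ) (a : ZMod (2 ^ ℓ)) : Bool := decide (a.val < 2 ^ (ℓ - 1))

/-- Random shares modulo `2 ^ ℓ` of `ReLU a`. -/
abbrev reluF (ℓ : ℕ) : Functionality where
  In := Pair (2 ^ ℓ)
  Out := Pair (2 ^ ℓ)
  eval v :=
    match joinPairs v with
    | some a =>
      (randomSharing (if drelu ℓ (secret a) then secret a else 0)).map fun z => some (pairs z)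
    | none => PMF.pure none

/-- Random shares modulo `2` of the bit `DReLU a`. -/
abbrev dreluF (ℓ : ℕ) : Functionality where
  In := Pair (2 ^ ℓ)
  Out := Pair 2
  eval v :=
    match joinPairs v with
    | some a =>
      (randomSharing (if drelu ℓ (secret a) then (1 : ZMod 2) else 0)).map
        fun z => some (pairs z)
    | none => PMF.pure none

/-- Preprocessing, 3-out-of-3 randomness: uniform `z` with `z 0 + z 1 + z 2 = 0`, party `i`
gets `z i`. -/
abbrev prepZeroF (m : ℕ) [NeZero m] : Functionality where
  In := Unit
  Out := ZMod m
  eval _ := (randomSharing (0 : ZMod m)).map some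

/-- Preprocessing, random shares of a uniform bit modulo `2` and modulo `m`. -/
abbrev prepBitF (m : ℕ) [NeZero m] : Functionality where
  In := Unit
  Out := Pair 2 × Pair m
  eval _ :=
    (PMF.uniformOfFintype Bool).bind fun b =>
      (randomSharing (if b then (1 : ZMod 2) else 0)).bind fun y =>
        (randomSharing (if b then (1 : ZMod m) else 0)).map fun z =>
          some fun i => (pairs y i, pairs z i)

/-- The calls of the (Mult, ReLU, Reconst, Prep)-hybrid model. -/
inductive Call where
  | mult (m : ℕ+)
  | relu
  | drelu
  | reconst (m : ℕ)
  | prepZero (m : ℕ+)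
  | prepBit (m : ℕ+)

/-- The hybrid model over the ring of integers modulo `2 ^ ℓ`. -/
abbrev hybrid (ℓ : ℕ) : Call → Functionality
  | .mult m => multF m
  | .relu => reluF ℓ
  | .drelu => dreluF ℓ
  | .reconst m => reconstF m
  | .prepZero m => prepZeroF m
  | .prepBit m => prepBitF m

/-! ### The bounding-power protocol -/

/-- What a party obtains: the bits of `α` revealed to it, most significant first, and `α` itself,
or `none` if the run was aborted. -/
abbrev PowOutput := List Bool × Option ℕ

/-- Local state of a party: its shares of `b`, the current `α`, its shares of the bit to be opened,
and the bits of `α` it has learned. -/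
structure PowLocal (ℓ : ℕ) where
  b : Pair (2 ^ ℓ)
  α : ℕ
  c : Pair 2
  bits : List Bool

/-- The comparison constant `2 ^ e`; constants beyond the range of positive ring elements are
represented by `2 ^ (ℓ - 1)`, which also exceeds every positive element, rather than wrapped
around modulo `2 ^ ℓ`. -/
def powConst (ℓ e : ℕ) : ZMod (2 ^ ℓ) := 2 ^ min e (ℓ - 1)

/-- `c ← DReLU(b - 2 ^ (2 ^ i + α))`, in shares. -/
abbrev powCompare (ℓ i : ℕ) : Round (hybrid ℓ) (PowLocal ℓ) where
  call := .drelu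
  send j s := addPublic (-powConst ℓ (2 ^ i + s.α)) j s.b
  recv _ s y := { s with c := y }

/-- Reconstruct `c`, and set `α ← α + 2 ^ i` if `c = 1`. -/
abbrev powOpen (ℓ i : ℕ) : Round (hybrid ℓ) (PowLocal ℓ) where
  call := .reconst 2
  send _ s := s.c
  recv _ s (y : ZMod 2) :=
    { s with
      α := if y = 1 then s.α + 2 ^ i else s.α
      bits := s.bits ++ [decide (y = 1)] }

/-- The iterations `n - 1, …, 1, 0`. -/
def powRounds (ℓ : ℕ) : ℕ → List (Round (hybrid ℓ) (PowLocal ℓ))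
  | 0 => []
  | i + 1 => powCompare ℓ i :: powOpen ℓ i :: powRounds ℓ i

/-- The bounding-power protocol with `n` iterations. -/
abbrev powProtocol (ℓ n : ℕ) : Protocol (hybrid ℓ) (Pair (2 ^ ℓ)) PowOutput where
  State := PowLocal ℓ
  start _ x := { b := x, α := 0, c := (0, 0), bits := [] }
  rounds := powRounds ℓ n
  finish _ s := (s.bits, some s.α)
  abort _ s := (s.bits, none)

/-! ### The bounding-power functionality -/

/-- Messages of the ideal-model adversary. -/
inductive PowMsg (ℓ : ℕ) where
  /-- The shares of the corrupted party. -/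
  | input (x : Pair (2 ^ ℓ))
  /-- Ask for the next bit of `α`. -/
  | next
  /-- Let the bit just received be sent to the honest parties. -/
  | deliver
  | abort

/-- Replies to the ideal-model adversary. -/
inductive PowReply where
  | ok
  | aborted
  | bit (b : Bool)

/-- States: `waiting` for the input of the corrupted party; `ready α k`: the bits of index at least
`k` have been sent to all parties; `pending α k`: the same for `k + 1`, and the adversary alone has
received bit `k`; `stopped`: aborted. The last field lists the bits sent to the honest parties. -/
inductive PowState (ℓ : ℕ) where
  | waiting (c : Fin 3) (h : Honest c → Pair (2 ^ ℓ))
  | ready (α k : ℕ) (bits : List Bool)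
  | pending (α k : ℕ) (bits : List Bool)
  | stopped (bits : List Bool)

/-- The unique `α` with `2 ^ α ≤ b < 2 ^ (α + 1)`, for `b ≠ 0`. -/
def exponent (b : ℕ) : ℕ := Nat.log 2 b

theorem exponent_spec {b : ℕ} (hb : b ≠ 0) : 2 ^ exponent b ≤ b ∧ b < 2 ^ (exponent b + 1) :=
  ⟨Nat.pow_log_le_self 2 hb, Nat.lt_pow_succ_log_self (by norm_num) b⟩

/-- One step of the functionality; after the last bit has been sent to all parties nothing can be
aborted any more, and messages out of turn are ignored. -/
def powStep (ℓ n : ℕ) : PowState ℓ → PowMsg ℓ → PowState ℓ × PowReply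
  | .waiting c h, .input x =>
    match joinPairs (withCorrupt c x h) with
    | some s => (.ready (exponent (secret s).val) n [], .ok)
    | none => (.stopped [], .aborted)
  | .waiting _ _, .abort => (.stopped [], .aborted)
  | .ready α (k + 1) bits, .next => (.pending α k bits, .bit (α.testBit k))
  | .ready _ (_ + 1) bits, .abort => (.stopped bits, .aborted)
  | .pending α k bits, .deliver => (.ready α k (bits ++ [α.testBit k]), .ok)
  | .pending _ _ bits, .abort => (.stopped bits, .aborted)
  | s, _ => (s, .ok)

/-- What the honest parties have received; a run that is left unfinished counts as aborted. -/
def powOut {ℓ : ℕ} : PowState ℓ → PowOutput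
  | .ready α 0 bits => (bits, some α)
  | .ready _ (_ + 1) bits => (bits, none)
  | .pending _ _ bits => (bits, none)
  | .stopped bits => (bits, none)
  | .waiting _ _ => ([], none)

/-- The functionality that reveals the `n` bits of `α` one by one, from the top. -/
abbrev powFunctionality (ℓ n : ℕ) : IdealFunctionality (Pair (2 ^ ℓ)) PowOutput where
  State := PowState ℓ
  Msg := PowMsg ℓ
  Reply := PowReply
  start c h := .waiting c h
  step := powStep ℓ n
  out s _ := powOut s

/-- Consistent shares of a positive number `b`, that is, `1 ≤ b < 2 ^ (ℓ - 1)`. -/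
def PowInput (ℓ : ℕ) (x : Fin 3 → Pair (2 ^ ℓ)) : Prop :=
  ∃ s : Fin 3 → ZMod (2 ^ ℓ), x = pairs s ∧
    1 ≤ (secret s).val ∧ (secret s).val < 2 ^ (ℓ - 1)

end MPC

end

noncomputable section

namespace MPC

/-! ### Uniform distributions -/

/-! Each of the two components held by the corrupted party is also held by an honest one, so a
functionality accepts its message exactly when it submits its true pair (`joinPairs_withCorrupt`).
Its only freedom is therefore to cause an abort, by refusing, by sending a wrong pair, or by
withholding delivery. A simulator that knows this pair recognizes each case.

What the corrupted party sees is also easy to simulate. Its pair from a fresh sharing is uniform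
whatever the secret (`randomSharing_bind_eq_uniform_bind`), so the simulator draws it without
knowing the bit. The opened value is bit `k` of the exponent of `b` (`drelu_sub_powConst`): if `α'`
collects the higher bits, that bit is set exactly when `2 ^ k + α'` is at most the exponent, that
is, when `2 ^ (2 ^ k + α') ≤ b`. This is the bit that the ideal functionality reveals at that
moment.

The simulator is not given the corrupted shares of `b`. It recovers them from the first comparison
message by undoing the shift by a public constant, and the ideal functionality tests their
consistency. The bound `ℓ ≤ 2 ^ n` makes the exponent fit in `n` bits, so that the initial value `α
= 0` is correct. From there the executions are matched iteration by iteration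
(`powSimIteration_run_eq`). -/

theorem uniformOfFintype_map_bijective {α β : Type} [Fintype α] [Nonempty α] [Fintype β]
    [Nonempty β] (f : α → β) (hf : Function.Bijective f) :
    (PMF.uniformOfFintype α).map f = PMF.uniformOfFintype β := by
  classical
  ext b
  obtain ⟨a, rfl⟩ := hf.2 b
  rw [PMF.map_apply, tsum_eq_single a]
  · simp [Fintype.card_of_bijective hf]
  · intro a' ha'
    simp [hf.1.eq_iff, ha'.symm]

/-! ### Replicated sharings -/

/-- The three components, reconstructed from what the honest parties and the corrupted party hold,
agree exactly when the corrupted party submits its true shares. -/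
theorem joinPairs_withCorrupt {m : ℕ} (c : Fin 3) (x : Pair m) (s : Fin 3 → ZMod m) :
    joinPairs (withCorrupt c x fun j => pairs s j.1) = if x = pairs s c then some s else none := by
  obtain ⟨x₁, x₂⟩ := x
  have hiff : (∀ i, (withCorrupt c (x₁, x₂) (fun j => pairs s j.1) i).2 =
      (withCorrupt c (x₁, x₂) (fun j => pairs s j.1) (i + 1)).1) ↔ (x₁, x₂) = pairs s c := by
    fin_cases c <;> simp [Fin.forall_fin_succ, withCorrupt, pairs, eq_comm, and_comm]
  unfold joinPairs
  simp only [hiff]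
  split_ifs with h
  · rw [h]
    congr 1
    funext i
    by_cases hi : i = c
    · subst hi; simp [withCorrupt, pairs]
    · simp [withCorrupt, pairs, hi]
  · rfl

/-- The sharing `s` with a public `t` added to the secret. -/
def shiftSharing {m : ℕ} (t : ZMod m) (s : Fin 3 → ZMod m) : Fin 3 → ZMod m :=
  fun i => if i = 0 then s i + t else s i

theorem addPublic_pairs {m : ℕ} (t : ZMod m) (s : Fin 3 → ZMod m) (i : Fin 3) :
    addPublic t i (pairs s i) = pairs (shiftSharing t s) i := rfl

theorem secret_shiftSharing {m : ℕ} (t : ZMod m) (s : Fin 3 → ZMod m) :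
    secret (shiftSharing t s) = secret s + t := by
  simp [secret, shiftSharing]
  ring

theorem addPublic_neg_addPublic {m : ℕ} (t : ZMod m) (i : Fin 3) (x : Pair m) :
    addPublic (-t) i (addPublic t i x) = x := by
  obtain ⟨x₁, x₂⟩ := x
  simp only [addPublic]
  split_ifs <;> simp

theorem addPublic_addPublic_neg {m : ℕ} (t : ZMod m) (i : Fin 3) (x : Pair m) :
    addPublic t i (addPublic (-t) i x) = x := by
  simpa using addPublic_neg_addPublic (-t) i x

/-- The two components of a random sharing held by one party are uniform, whatever the secret. -/
theorem randomSharing_map_pairs {m : ℕ} [NeZero m] (a : ZMod m) (c : Fin 3) :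
    (randomSharing a).map (fun z => pairs z c) = PMF.uniformOfFintype (Pair m) := by
  rw [randomSharing, PMF.map_comp]
  apply uniformOfFintype_map_bijective
  -- Source and target are the same finite type, so injectivity suffices; it holds because two
  -- components and the fixed sum determine the third.
  rw [← Finite.injective_iff_bijective]
  rintro ⟨r₁, r₂⟩ ⟨t₁, t₂⟩ h
  fin_cases c <;> simp [pairs] at h <;> obtain ⟨h₁, h₂⟩ := h <;> subst_vars <;> simp_all

theorem secret_of_mem_support_randomSharing {m : ℕ} [NeZero m] {a : ZMod m} {z : Fin 3 → ZMod m}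
    (hz : z ∈ (randomSharing a).support) : secret z = a := by
  rw [randomSharing, PMF.mem_support_map_iff] at hz
  obtain ⟨r, -, rfl⟩ := hz
  simp [secret]

/-- Lets a sharing drawn from `randomSharing a` be assumed to have secret `a`. -/
theorem bind_congr_of_mem_support {α β : Type} (p : PMF α) {f g : α → PMF β}
    (h : ∀ a ∈ p.support, f a = g a) : p.bind f = p.bind g := by
  ext b
  rw [PMF.bind_apply, PMF.bind_apply]
  refine tsum_congr fun a => ?_
  by_cases ha : p a = 0
  · simp [ha]
  · rw [h a ((PMF.mem_support_iff p a).2 ha)]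

/-- An experiment that depends on a random sharing of `a` only through the secret `a` and what
party `c` holds can be run with uniform shares for party `c`. -/
theorem randomSharing_bind_eq_uniform_bind {m : ℕ} [NeZero m] (a : ZMod m) (c : Fin 3) {β : Type}
    {f : (Fin 3 → ZMod m) → PMF β} {g : Pair m → PMF β}
    (h : ∀ z, secret z = a → f z = g (pairs z c)) :
    (randomSharing a).bind f = (PMF.uniformOfFintype (Pair m)).bind g := by
  rw [← randomSharing_map_pairs a c, PMF.bind_map]
  exact bind_congr_of_mem_support _ fun z hz => h z (secret_of_mem_support_randomSharing hz)

/-- The four pairs of bits. -/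
def bitPair (r : Fin 4) : Pair 2 := ((finProdFinEquiv.symm r : Fin 2 × Fin 2) : ZMod 2 × ZMod 2)

/-- Simulators draw only from `Fin (m + 1)`; a uniform pair of bits is thus one draw from four
values, `ZMod 2` being `Fin 2` by definition. -/
theorem uniformOfFintype_map_bitPair :
    (PMF.uniformOfFintype (Fin (3 + 1))).map bitPair = PMF.uniformOfFintype (Pair 2) :=
  uniformOfFintype_map_bijective _ (finProdFinEquiv (m := 2) (n := 2)).symm.bijective

/-! ### The comparison bits -/

theorem val_powConst {ℓ : ℕ} (hℓ : 1 ≤ ℓ) (e : ℕ) :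
    (powConst ℓ e).val = 2 ^ min e (ℓ - 1) := by
  have : powConst ℓ e = ((2 ^ min e (ℓ - 1) : ℕ) : ZMod (2 ^ ℓ)) := by simp [powConst]
  rw [this, ZMod.val_natCast, Nat.mod_eq_of_lt]
  exact Nat.pow_lt_pow_right (by norm_num) (by omega)

/-- The sign bit of `b - t` compares `b < 2 ^ (ℓ - 1)` and `t ≤ 2 ^ (ℓ - 1)` correctly. -/
theorem drelu_sub {ℓ : ℕ} (hℓ : 1 ≤ ℓ) {b t : ZMod (2 ^ ℓ)} (hb : b.val < 2 ^ (ℓ - 1))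
    (ht : t.val ≤ 2 ^ (ℓ - 1)) : drelu ℓ (b + -t) = decide (t.val ≤ b.val) := by
  have h2 : 2 ^ ℓ = 2 * 2 ^ (ℓ - 1) := by rw [← pow_succ']; congr 1; omega
  unfold drelu
  congr 1
  rw [← sub_eq_add_neg]
  by_cases h : t.val ≤ b.val
  · rw [ZMod.val_sub h]
    simp only [h, iff_true, eq_iff_iff]
    omega
  -- The difference wraps around to `b + 2 ^ ℓ - t`, which is at least `2 ^ (ℓ - 1)` because `t ≤ 2
  -- ^ (ℓ - 1)`. Equality is allowed for `t`, as the clamped constant requires.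
  · have hne : t ≠ 0 := by rintro rfl; simp at h
    have : b - t = ((b.val + (2 ^ ℓ - t.val) : ℕ) : ZMod (2 ^ ℓ)) := by
      have := ZMod.val_lt t
      push_cast [Nat.cast_sub this.le]
      have h0 : (2 : ZMod (2 ^ ℓ)) ^ ℓ = 0 := by
        have h := ZMod.natCast_self (2 ^ ℓ)
        rwa [Nat.cast_pow, Nat.cast_ofNat] at h
      simp [h0, sub_eq_add_neg]
    rw [this, ZMod.val_natCast, Nat.mod_eq_of_lt (by omega)]
    simp only [h, iff_false, eq_iff_iff]
    omega

/-- The bits of index at least `k` of `α`, as a number. -/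
def topBits (α k : ℕ) : ℕ := α / 2 ^ k * 2 ^ k

theorem topBits_zero (α : ℕ) : topBits α 0 = α := by simp [topBits]

theorem topBits_of_lt {α k : ℕ} (h : α < 2 ^ k) : topBits α k = 0 := by
  simp [topBits, Nat.div_eq_of_lt h]

/-- This is the protocol's update of `α`: the quotient by `2 ^ k` is twice the quotient by `2 ^ (k +
1)` plus bit `k`. -/
theorem topBits_eq_add (α k : ℕ) :
    topBits α k = if α.testBit k then topBits α (k + 1) + 2 ^ k else topBits α (k + 1) := by
  have h1 : α / 2 ^ (k + 1) = α / 2 ^ k / 2 := by rw [pow_succ, Nat.div_div_eq_div_mul]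
  have h2 := Nat.div_add_mod (α / 2 ^ k) 2
  have h3 : topBits α k = topBits α (k + 1) + (α / 2 ^ k % 2) * 2 ^ k := by
    unfold topBits
    rw [h1, pow_succ]
    conv_lhs => rw [← h2]
    ring
  rw [h3, Nat.testBit_eq_decide_div_mod_eq]
  rcases Nat.mod_two_eq_zero_or_one (α / 2 ^ k) with h | h <;> simp [h]

/-- Since `topBits α k ≤ α < topBits α k + 2 ^ k`, adding `2 ^ k` to the bits above `k` stays at or
below `α` if bit `k` is set and overshoots otherwise. -/
theorem testBit_eq_decide_le (α k : ℕ) :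
    α.testBit k = decide (2 ^ k + topBits α (k + 1) ≤ α) := by
  have h := topBits_eq_add α k
  have h1 : topBits α k ≤ α := Nat.div_mul_le_self _ _
  have h2 : α < topBits α k + 2 ^ k := by
    have := Nat.div_add_mod α (2 ^ k)
    have := Nat.mod_lt α (Nat.two_pow_pos k)
    unfold topBits
    rw [mul_comm]
    omega
  cases hb : α.testBit k <;> simp [hb] at h <;> simp <;> omega

/-- Comparing `b` with `2 ^ (2 ^ k + α')`, where `α'` collects the bits above `k` of the exponent of
`b`, yields bit `k` of that exponent. -/
theorem drelu_sub_powConst {ℓ : ℕ} {b : ZMod (2 ^ ℓ)} (hb₁ : 1 ≤ b.val)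
    (hb : b.val < 2 ^ (ℓ - 1)) (k : ℕ) :
    drelu ℓ (b + -powConst ℓ (2 ^ k + topBits (exponent b.val) (k + 1))) =
      (exponent b.val).testBit k := by
  -- For `ℓ = 0` the truncated `ℓ - 1` is `0`, and no `b` satisfies `1 ≤ b < 1`.
  have hℓ : 1 ≤ ℓ := by
    by_contra h
    have : ℓ - 1 = 0 := by omega
    rw [this] at hb
    omega
  have hα : exponent b.val < ℓ - 1 := Nat.log_lt_of_lt_pow (by omega) hb
  rw [drelu_sub hℓ hb, testBit_eq_decide_le, val_powConst hℓ]
  · congr 1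
    set e := 2 ^ k + topBits (exponent b.val) (k + 1)
    rw [eq_iff_iff]
    -- The exponent lies strictly below `ℓ - 1`, so clamping `e` at `ℓ - 1` does not change whether
    -- it is at most the exponent.
    have : 2 ^ min e (ℓ - 1) ≤ b.val ↔ min e (ℓ - 1) ≤ exponent b.val :=
      (Nat.le_log_iff_pow_le (by norm_num) (by omega)).symm
    rw [this]
    omega
  · rw [val_powConst hℓ]
    exact Nat.pow_le_pow_right (by norm_num) (by omega)

/-! ### The simulator -/

/-- One iteration of the simulation, once the message of the corrupted party for the comparison has
been found to be correct and its shares `y` of the bit have been drawn: hand them out, check that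
they are submitted unchanged for reconstruction, and open the bit received from the ideal
functionality. -/
def powSimOpen (ℓ k a : ℕ) (next : ℕ → Simulator (hybrid ℓ) (PowMsg ℓ) PowReply) (y : Pair 2) :
    Simulator (hybrid ℓ) (PowMsg ℓ) PowReply :=
  .giveOutput .drelu y fun
    | false => .ideal .abort fun _ => .halt
    | true => .askInput (.reconst 2) fun (y' : Option (Pair 2)) =>
      match y' with
      | none => .ideal .abort fun _ => .halt
      | some y' =>
        if y' = y then
          .ideal .next fun
            | .bit β =>
              .giveOutput (.reconst 2) (if β then (1 : ZMod 2) else 0) fun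
                | false => .ideal .abort fun _ => .halt
                | true => .ideal .deliver fun _ => next (if β then a + 2 ^ k else a)
            | _ => .halt
        else .ideal .abort fun _ => .tellAbort (.reconst 2) .halt

/-- One iteration of the simulation with uniform shares of the bit. -/
def powSimIteration (ℓ k a : ℕ) (next : ℕ → Simulator (hybrid ℓ) (PowMsg ℓ) PowReply) :
    Simulator (hybrid ℓ) (PowMsg ℓ) PowReply :=
  .uniform 3 fun r => powSimOpen ℓ k a next (bitPair r)

/-- The iterations `k - 1, …, 0` of the simulation, when the bits of `α` revealed so far add up to
`a` and the corrupted party holds the shares `x` of `b`. -/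
def powSimRounds (ℓ : ℕ) (c : Fin 3) (x : Pair (2 ^ ℓ)) :
    ℕ → ℕ → Simulator (hybrid ℓ) (PowMsg ℓ) PowReply
  | 0, _ => .halt
  | k + 1, a => .askInput .drelu fun (y : Option (Pair (2 ^ ℓ))) =>
    match y with
    | none => .ideal .abort fun _ => .halt
    | some y =>
      if y = addPublic (-powConst ℓ (2 ^ k + a)) c x then
        powSimIteration ℓ k a (powSimRounds ℓ c x k)
      else .ideal .abort fun _ => .tellAbort .drelu .halt

/-- The simulator: it extracts the shares of the corrupted party from its message for the first
comparison, whose constant is public. -/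
def powSim (ℓ n : ℕ) (c : Fin 3) : Simulator (hybrid ℓ) (PowMsg ℓ) PowReply :=
  match n with
  | 0 => .halt
  | k + 1 => .askInput .drelu fun (y : Option (Pair (2 ^ ℓ))) =>
    match y with
    | none => .ideal .abort fun _ => .halt
    | some y =>
      .ideal (.input (addPublic (powConst ℓ (2 ^ k)) c y)) fun
        | .ok => powSimIteration ℓ k 0
            (powSimRounds ℓ c (addPublic (powConst ℓ (2 ^ k)) c y) k)
        | _ => .tellAbort .drelu .halt

/-! ### Real and ideal executions agree -/

/-- The honest parties hold their parts of the sharing `σ` of `b`, and have learned `bits`, which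
add up to `a`. -/
def LocalsMatch {ℓ : ℕ} {c : Fin 3} (σ : Fin 3 → ZMod (2 ^ ℓ)) (a : ℕ) (bits : List Bool)
    (s : Honest c → PowLocal ℓ) : Prop :=
  ∀ j, (s j).b = pairs σ j.1 ∧ (s j).α = a ∧ (s j).bits = bits

theorem dreluF_eval {ℓ : ℕ} {v : Fin 3 → Pair (2 ^ ℓ)} {a : Fin 3 → ZMod (2 ^ ℓ)}
    (h : joinPairs v = some a) :
    (dreluF ℓ).eval v = (randomSharing (if drelu ℓ (secret a) then (1 : ZMod 2) else 0)).map
      fun z => some (pairs z) := by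
  simp only [h]

theorem dreluF_eval_none {ℓ : ℕ} {v : Fin 3 → Pair (2 ^ ℓ)} (h : joinPairs v = none) :
    (dreluF ℓ).eval v = PMF.pure none := by
  simp only [h]

/-- Opening a bit shared as `z`, for any continuation that agrees with the simulated one. -/
theorem run_powOpen {ℓ n : ℕ} {c : Fin 3} (A : Adversary (hybrid ℓ))
    (rest : List (Round (hybrid ℓ) (PowLocal ℓ))) (k : ℕ) (β : Bool)
    (z : Fin 3 → ZMod 2) (hz : secret z = if β then 1 else 0)
    {a : ℕ} {bits : List Bool} {s : Honest c → PowLocal ℓ}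
    (hα : ∀ j, (s j).α = a) (hbits : ∀ j, (s j).bits = bits) (hc : ∀ j, (s j).c = pairs z j.1)
    (v : View (hybrid ℓ)) :
    (powProtocol ℓ n).run c A (powOpen ℓ k :: rest) s v =
      (A.input v (.reconst 2)).bind fun (y : Option (Pair 2)) =>
        match y with
        | none => PMF.pure (v ++ [Event.input (.reconst 2) none], fun _ : Honest c => ((bits, none) : PowOutput))
        | some y =>
          if y = pairs z c then
            (A.deliver (v ++ [Event.input (.reconst 2) (some y),
                Event.output (F := hybrid ℓ) (.reconst 2) (if β then (1 : ZMod 2) else 0)]) (.reconst 2)).bind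
              fun
              | false => PMF.pure (v ++ [Event.input (.reconst 2) (some y),
                  Event.output (F := hybrid ℓ) (.reconst 2) (if β then (1 : ZMod 2) else 0),
                  Event.deliver (.reconst 2) false], fun _ : Honest c => ((bits, none) : PowOutput))
              | true => (powProtocol ℓ n).run c A rest
                  (fun j => { s j with
                    α := if β then a + 2 ^ k else a
                    bits := bits ++ [β] })
                  (v ++ [Event.input (.reconst 2) (some y),
                    Event.output (F := hybrid ℓ) (.reconst 2) (if β then (1 : ZMod 2) else 0),
                    Event.deliver (.reconst 2) true])
          else PMF.pure (v ++ [Event.input (.reconst 2) (some y), Event.aborted (.reconst 2)],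
              fun _ : Honest c => ((bits, none) : PowOutput)) := by
  rw [Protocol.run]
  congr 1
  funext y
  rcases y with _ | y
  · simp [hbits]
  have hsend : (fun j : Honest c => (powOpen ℓ k).send j.1 (s j)) = fun j => pairs z j.1 :=
    funext hc
  dsimp only
  rw [hsend]
  rw [joinPairs_withCorrupt]
  by_cases hy : y = pairs z c
  · rw [if_pos hy, if_pos hy]
    rw [Option.map_some, PMF.pure_bind]
    dsimp only
    -- The opened value is the secret itself, so the corrupted party can stop the opening but not
    -- alter the bit.
    rw [hz]
    congr 1
    funext d
    cases d
    · simp [hbits]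
    · cases β <;> simp [hα, hbits]
  · rw [if_neg hy, if_neg hy]
    rw [Option.map_none, PMF.pure_bind]
    simp [hbits]

/-- The opening depends on the sharing `z` only through the bit `β` and the corrupted pair, against
which the resubmitted pair is checked; hence a uniform pair can replace it. The continuation is left
abstract so that the first iteration, with its input extraction, and the later ones share this
argument. -/
theorem powSimIteration_run_eq {ℓ n : ℕ} {c : Fin 3} (A : Adversary (hybrid ℓ))
    (rest : List (Round (hybrid ℓ) (PowLocal ℓ))) (k : ℕ) (β : Bool) {α : ℕ}
    (hβ : α.testBit k = β) {a : ℕ} {bits : List Bool} {s : Honest c → PowLocal ℓ}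
    {σ : Fin 3 → ZMod (2 ^ ℓ)} (hs : LocalsMatch σ a bits s)
    {next : ℕ → Simulator (hybrid ℓ) (PowMsg ℓ) PowReply}
    (hnext : ∀ (s' : Honest c → PowLocal ℓ) (v : View (hybrid ℓ)),
      LocalsMatch σ (if β then a + 2 ^ k else a) (bits ++ [β]) s' →
      (powProtocol ℓ n).run c A rest s' v =
        (next (if β then a + 2 ^ k else a)).run (powFunctionality ℓ n) c A
          (.ready α k (bits ++ [β])) v)
    (v : View (hybrid ℓ)) :
    ((randomSharing (if β then (1 : ZMod 2) else 0)).bind fun z =>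
      (A.deliver (v ++ [Event.output .drelu (pairs z c)]) .drelu).bind fun
        | false => PMF.pure (v ++ [Event.output .drelu (pairs z c), Event.deliver .drelu false],
            fun _ : Honest c => ((bits, none) : PowOutput))
        | true => (powProtocol ℓ n).run c A (powOpen ℓ k :: rest)
            (fun j => { s j with c := pairs z j.1 })
            (v ++ [Event.output .drelu (pairs z c), Event.deliver .drelu true])) =
      (powSimIteration ℓ k a next).run (powFunctionality ℓ n) c A (.ready α (k + 1) bits) v := by
  have hrun : (powSimIteration ℓ k a next).run (powFunctionality ℓ n) c A
      (.ready α (k + 1) bits) v = (PMF.uniformOfFintype (Pair 2)).bind fun y =>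
        (powSimOpen ℓ k a next y).run (powFunctionality ℓ n) c A (.ready α (k + 1) bits) v := by
    rw [← uniformOfFintype_map_bitPair, PMF.bind_map]
    rfl
  rw [hrun]
  refine randomSharing_bind_eq_uniform_bind _ c fun z hz => ?_
  rw [powSimOpen, Simulator.run]
  congr 1
  funext d
  cases d
  · rfl
  dsimp only
  rw [run_powOpen (s := fun j => { s j with c := pairs z j.1 }) A rest k β z hz (a := a) (bits := bits) (fun j => (hs j).2.1)
    (fun j => (hs j).2.2) (fun _ => rfl), Simulator.run]
  congr 1
  funext y
  rcases y with _ | y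
  · rfl
  dsimp only
  by_cases hy : y = pairs z c
  · rw [if_pos hy, if_pos hy, Simulator.run]
    simp only [powStep, hβ]
    rw [Simulator.run]
    congr 1
    · simp
    funext d
    cases d
    -- The adversary has seen bit `k`, but the functionality is still `pending`, so the honest
    -- output stops at `bits`, as in the protocol.
    · simp [Simulator.run, powStep, powOut]
    · dsimp only
      refine (hnext _ _ ?_).trans ?_
      · exact fun j => ⟨(hs j).1, rfl, rfl⟩
      simp [Simulator.run, powStep, hβ]
  · rw [if_neg hy, if_neg hy]
    simp [Simulator.run, powStep, powOut]

/-- A comparison followed by an opening: the corrupted party has to submit its true shares. -/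
theorem run_powCompare {ℓ n : ℕ} {c : Fin 3} (A : Adversary (hybrid ℓ))
    (rest : List (Round (hybrid ℓ) (PowLocal ℓ))) (k : ℕ) (β : Bool) {a : ℕ} {bits : List Bool}
    {s : Honest c → PowLocal ℓ} {σ : Fin 3 → ZMod (2 ^ ℓ)} (hs : LocalsMatch σ a bits s)
    (hβ : drelu ℓ (secret σ + -powConst ℓ (2 ^ k + a)) = β) (v : View (hybrid ℓ)) :
    (powProtocol ℓ n).run c A (powCompare ℓ k :: rest) s v =
      (A.input v .drelu).bind fun (x : Option (Pair (2 ^ ℓ))) =>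
        match x with
        | none => PMF.pure (v ++ [Event.input .drelu none],
            fun _ : Honest c => ((bits, none) : PowOutput))
        | some x =>
          if x = addPublic (-powConst ℓ (2 ^ k + a)) c (pairs σ c) then
            (randomSharing (if β then (1 : ZMod 2) else 0)).bind fun z =>
              (A.deliver ((v ++ [Event.input .drelu (some x)]) ++
                [Event.output .drelu (pairs z c)]) .drelu).bind fun
                | false => PMF.pure ((v ++ [Event.input .drelu (some x)]) ++
                    [Event.output .drelu (pairs z c), Event.deliver .drelu false],
                    fun _ : Honest c => ((bits, none) : PowOutput))
                | true => (powProtocol ℓ n).run c A rest (fun j => { s j with c := pairs z j.1 })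
                    ((v ++ [Event.input .drelu (some x)]) ++
                      [Event.output .drelu (pairs z c), Event.deliver .drelu true])
          else PMF.pure (v ++ [Event.input .drelu (some x), Event.aborted .drelu],
            fun _ : Honest c => ((bits, none) : PowOutput)) := by
  rw [Protocol.run]
  congr 1
  funext x
  rcases x with _ | x
  · simp [fun j => (hs j).2.2]
  have hsend : (fun j : Honest c => (powCompare ℓ k).send j.1 (s j)) =
      fun j => pairs (shiftSharing (-powConst ℓ (2 ^ k + a)) σ) j.1 := by
    funext j
    dsimp only
    rw [(hs j).1, (hs j).2.1, addPublic_pairs]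
  dsimp only
  rw [hsend, addPublic_pairs]
  have hjoin := joinPairs_withCorrupt c x (shiftSharing (-powConst ℓ (2 ^ k + a)) σ)
  by_cases hx : x = pairs (shiftSharing (-powConst ℓ (2 ^ k + a)) σ) c
  · rw [if_pos hx] at hjoin ⊢
    have heval := dreluF_eval hjoin
    rw [secret_shiftSharing, hβ] at heval
    change ((dreluF ℓ).eval _).bind _ = _
    rw [heval, PMF.bind_map]
    congr 1
    funext z
    simp only [Function.comp]
    congr 1
    · simp
    funext d
    cases d
    · simp [fun j => (hs j).2.2]
    · simp
  · rw [if_neg hx] at hjoin ⊢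
    change ((dreluF ℓ).eval _).bind _ = _
    rw [dreluF_eval_none hjoin, PMF.pure_bind]
    simp [fun j => (hs j).2.2]

/-- Induction on the number of remaining iterations, with the invariant that the local `α` is
`topBits` of the exponent. At `k = 0` this is the whole exponent, the value that the functionality
outputs. -/
theorem powSimRounds_run_eq {ℓ n : ℕ} {c : Fin 3} (A : Adversary (hybrid ℓ))
    {σ : Fin 3 → ZMod (2 ^ ℓ)} (hpos : 1 ≤ (secret σ).val)
    (hlt : (secret σ).val < 2 ^ (ℓ - 1)) (k : ℕ) (bits : List Bool) (s : Honest c → PowLocal ℓ)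
    (v : View (hybrid ℓ))
    (hs : LocalsMatch σ (topBits (exponent (secret σ).val) k) bits s) :
    (powProtocol ℓ n).run c A (powRounds ℓ k) s v =
      (powSimRounds ℓ c (pairs σ c) k (topBits (exponent (secret σ).val) k)).run
        (powFunctionality ℓ n) c A (.ready (exponent (secret σ).val) k bits) v := by
  induction k generalizing bits s v with
  | zero =>
    simp only [powRounds, Protocol.run, powSimRounds, Simulator.run, powOut]
    simp [(hs _).2.1, (hs _).2.2, topBits_zero]
  | succ k ih =>
    rw [powRounds, run_powCompare A _ k _ hs (drelu_sub_powConst hpos hlt k), powSimRounds,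
      Simulator.run]
    congr 1
    funext x
    rcases x with _ | x
    · rfl
    dsimp only
    by_cases hx : x = addPublic
        (-powConst ℓ (2 ^ k + topBits (exponent (secret σ).val) (k + 1))) c (pairs σ c)
    · rw [if_pos hx, if_pos hx]
      refine powSimIteration_run_eq A _ k ((exponent (secret σ).val).testBit k)
        (α := exponent (secret σ).val) rfl hs (fun s' w hs' => ?_) _
      rw [← topBits_eq_add] at hs' ⊢
      exact ih _ _ _ hs'
    · rw [if_neg hx, if_neg hx]
      simp [Simulator.run, powStep, powOut]

/-- The first iteration is separate because the functionality is still `waiting`: the message for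
the comparison also supplies its missing input. By `hexp`, `topBits` starts at `0`. -/
theorem powSim_run_eq {ℓ k : ℕ} {c : Fin 3} (A : Adversary (hybrid ℓ))
    {σ : Fin 3 → ZMod (2 ^ ℓ)} (hpos : 1 ≤ (secret σ).val)
    (hlt : (secret σ).val < 2 ^ (ℓ - 1)) (hexp : exponent (secret σ).val < 2 ^ (k + 1)) :
    (powProtocol ℓ (k + 1)).exec c A (pairs σ) =
      Simulator.exec (G := powFunctionality ℓ (k + 1)) (powSim ℓ (k + 1) c) c A (pairs σ) := by
  have htop := topBits_of_lt hexp
  have hβ := drelu_sub_powConst hpos hlt k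
  rw [htop] at hβ
  have hs : LocalsMatch σ 0 [] fun j : Honest c =>
      (powProtocol ℓ (k + 1)).start j.1 (pairs σ j.1) := fun j => ⟨rfl, rfl, rfl⟩
  rw [Protocol.exec, Simulator.exec]
  change (powProtocol ℓ (k + 1)).run c A (powCompare ℓ k :: powOpen ℓ k :: powRounds ℓ k) _ _ = _
  rw [run_powCompare A _ k _ hs hβ, powSim, Simulator.run]
  congr 1
  funext x
  rcases x with _ | x
  · rfl
  dsimp only
  rw [Simulator.run, add_zero]
  have hjoin := joinPairs_withCorrupt c (addPublic (powConst ℓ (2 ^ k)) c x) σ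
  by_cases hx : x = addPublic (-powConst ℓ (2 ^ k)) c (pairs σ c)
  · have hx' : addPublic (powConst ℓ (2 ^ k)) c x = pairs σ c := by
      rw [hx, addPublic_addPublic_neg]
    rw [if_pos hx'] at hjoin
    rw [if_pos hx]
    simp only [powStep, hjoin]
    rw [hx']
    refine powSimIteration_run_eq A _ k ((exponent (secret σ).val).testBit k)
        (α := exponent (secret σ).val) rfl hs (fun s' w hs' => ?_) _
    have ha := topBits_eq_add (exponent (secret σ).val) k
    rw [htop] at ha
    rw [← ha] at hs' ⊢
    exact powSimRounds_run_eq A hpos hlt k _ s' w hs'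
  -- A wrong message shifts back to a wrong pair, so the ideal functionality aborts by itself, with
  -- no bits revealed, just as the real comparison does.
  · have hx' : addPublic (powConst ℓ (2 ^ k)) c x ≠ pairs σ c := by
      intro h
      rw [← h, addPublic_neg_addPublic] at hx
      exact hx rfl
    rw [if_neg hx'] at hjoin
    rw [if_neg hx]
    simp only [powStep, hjoin]
    simp [Simulator.run, powOut]

end MPC

end

theorem theorem5 (ℓ n : ℕ) (hℓ : 1 ≤ ℓ) (hn : ℓ ≤ 2 ^ n) :
    MPC.SecurelyRealizesWithAbort (MPC.powProtocol ℓ n) (MPC.powFunctionality ℓ n)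
      (MPC.PowInput ℓ) := by
  refine fun c => ⟨MPC.powSim ℓ n c, ?_⟩
  rintro A _ ⟨σ, rfl, hpos, hlt⟩
  have hexp : MPC.exponent (MPC.secret σ).val < ℓ - 1 := Nat.log_lt_of_lt_pow (by omega) hlt
  obtain _ | k := n
  -- With no iterations `ℓ ≤ 1`, which leaves no room for an exponent below `ℓ - 1`.
  · rw [pow_zero] at hn
    omega
  · exact MPC.powSim_run_eq (A (MPC.pairs σ c)) hpos hlt (by omega)
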